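/- Let $n>k>0$ be coprime integers with $n\ge 3$. The Johnson graph $J_{n,k}$ has as vertices all bitstrings of length $n$ with exactly $k$ ones, two of them being adjacent if they differ in a transposition of a $0$ and a $1$. Put $N:=\binom{n}{k}$. Then $n$ divides $N$, and $J_{n,k}$ has a Hamilton cycle $C=(x_0,\ldots,x_{N-1})$ with the following properties (indices of the $x_i$ are taken modulo $N$): - $C$ is $n$-symmetric under the automorphism $f$ of $J_{n,k}$ that cyclically shifts all bits to the left by one position, $f(b_1b_2\cdots b_n)=b_2\cdots b_nb_1$; that is, $f(x_i)=x_{i+N/n}$ for all $i$. - $C$ has $1$ track: in the $N\times n$ matrix with rows $x_0,\ldots,x_{N-1}$ there is one column such that every column is a cyclically shifted copy of it. - $C$ is balanced: along the cycle (including the step from $x_{N-1}$ back to $x_0$) each bit is flipped equally often, namely $2\binom{n}{k}/n$ times: $\binom{n}{k}/n$ times from $0$ to $1$ and $\binom{n}{k}/n$ times from $1$ to $0$. -/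

import Mathlib

/-- The `(n,k)`-combinations: bitstrings of length `n` with Hamming weight `k`. -/
abbrev Combination (n k : ℕ) : Type :=
  {x : Fin n → Bool // (Finset.univ.filter fun i => x i = true).card = k}

/-- The Johnson graph `J_{n,k}`: two `(n,k)`-combinations are adjacent iff one arises from the other
by transposing a 0 and a 1. -/
def johnsonGraph (n k : ℕ) : SimpleGraph (Combination n k) where
  Adj x y := ∃ i j : Fin n, x.1 i = false ∧ x.1 j = true ∧ y.1 = x.1 ∘ Equiv.swap i j
  symm := ⟨by
    rintro x y ⟨i, j, hi, hj, h⟩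
    refine ⟨j, i, ?_, ?_, ?_⟩
    · simp [h, hi]
    · simp [h, hj]
    · rw [h, Function.comp_assoc, Equiv.swap_comm j i, ← Equiv.coe_trans]
      simp⟩
  loopless := ⟨by
    rintro x ⟨i, j, hi, hj, h⟩
    have := congrFun h i
    simp [hi, hj] at this⟩

/-- The bijection on `(n,k)`-combinations given by the cyclic left shift by one position,
`x₁ x₂ ⋯ xₙ ↦ x₂ ⋯ xₙ x₁`; note that `finRotate n` is `i ↦ i + 1` modulo `n`. -/
def leftShiftEquiv (n k : ℕ) : Combination n k ≃ Combination n k :=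
  ((finRotate n).symm.arrowCongr (Equiv.refl Bool)).subtypeEquiv fun x => by
    rw [← Finset.card_map (finRotate n).symm.toEmbedding]
    congr! 2
    ext i
    simp [Equiv.arrowCongr]

theorem leftShiftEquiv_apply {n k : ℕ} (x : Combination n k) (i : Fin n) :
    (leftShiftEquiv n k x).1 i = x.1 (finRotate n i) := rfl

/-- The cyclic left shift by one position as an automorphism of the Johnson graph. -/
def leftShift (n k : ℕ) : johnsonGraph n k ≃g johnsonGraph n k where
  toEquiv := leftShiftEquiv n k
  map_rel_iff' := by
    intro x y
    constructor
    · rintro ⟨i, j, hi, hj, h⟩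
      refine ⟨finRotate n i, finRotate n j, hi, hj, ?_⟩
      funext l
      obtain ⟨l, rfl⟩ := (finRotate n).surjective l
      have := congrFun h l
      simp only [leftShiftEquiv_apply, Function.comp_apply] at this ⊢
      rw [this, (finRotate n).injective.map_swap]
    · rintro ⟨i, j, hi, hj, h⟩
      obtain ⟨i, rfl⟩ := (finRotate n).surjective i
      obtain ⟨j, rfl⟩ := (finRotate n).surjective j
      refine ⟨i, j, hi, hj, ?_⟩
      funext l
      have := congrFun h (finRotate n l)
      simp only [leftShiftEquiv_apply, Function.comp_apply] at this ⊢
      rw [this, (finRotate n).injective.map_swap]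

/-- A closed walk `C = (x₀, …, x_{N-1}, x₀)` is `m`-symmetric under the automorphism `f` if `m` divides
`N` and `f` is the map `x_i ↦ x_{i+N/m}`, with indices modulo `N`. -/
def IsSymmetricUnder {V : Type*} {G : SimpleGraph V} {v : V} (C : G.Walk v v) (m : ℕ)
    (f : G ≃g G) : Prop :=
  m ∣ C.length ∧
    ∀ i < C.length, f (C.getVert i) = C.getVert ((i + C.length / m) % C.length)

section

variable {n k : ℕ} {v : Combination n k}

/-- Column `j` of the `N × n` matrix whose rows are the strings `x₀, …, x_{N-1}` visited by the
closed walk `C = (x₀, …, x_{N-1}, x₀)`. -/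
def column (C : (johnsonGraph n k).Walk v v) (j : Fin n) : List Bool :=
  (List.range C.length).map fun i => (C.getVert i).1 j

/-- `C` consists of `t` tracks: there are `t` columns such that every column is a cyclically shifted
copy of one of these. -/
def HasTracks (C : (johnsonGraph n k).Walk v v) (t : ℕ) : Prop :=
  ∃ T : Finset (Fin n), T.card = t ∧ ∀ j, ∃ j₀ ∈ T, column C j₀ ~r column C j

/-- The number of steps of the closed walk `C` (the last step leads back to the start) in which
bit `j` changes from `b` to its complement. -/
def flipCountFrom (C : (johnsonGraph n k).Walk v v) (j : Fin n) (b : Bool) : ℕ :=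
  ((Finset.range C.length).filter fun i =>
    (C.getVert i).1 j = b ∧ (C.getVert (i + 1)).1 j = !b).card

/-- The number of steps of the closed walk `C` (the last step leads back to the start) in which
bit `j` is flipped. -/
def flipCount (C : (johnsonGraph n k).Walk v v) (j : Fin n) : ℕ :=
  ((Finset.range C.length).filter fun i => (C.getVert i).1 j ≠ (C.getVert (i + 1)).1 j).card

end

/-! The cyclic shift `f` splits the combinations into orbits. As `n` and `k` are coprime, the cycle
lemma says that each orbit has `n` elements and contains exactly one rational Dyck word
(`exists_isDyck_rotation`, `IsDyck.rotation_unique`). It therefore suffices to find a path through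
the Dyck words from some `s` to some `r` with `r` adjacent to `f s`: the path followed by its images
under `f`, `f²`, …, `fⁿ⁻¹` closes up to a Hamilton cycle on which `f` acts as a shift
(`exists_symmetric_sequence`).

The path comes from `exists_exchange_path`. A Dyck word is a `k`-set with at least `⌈mk/n⌉` elements
below each `m`. Such sets are grouped by their largest element `j`; removing `j` leaves a set of the
same kind, so induction on `k` gives a path in each group. Its ends, apart from `j`, do not depend
on `j`, so the groups can be traversed alternately backwards and forwards.

Single track and balance follow from the symmetry: the shift carries each column to the next one,
and every step makes one flip in each direction. -/

/-! ### Alternating concatenation of paths -/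

/-- Concatenation of the blocks `ℓ j₁, ℓ' j₂, ℓ j₃, …`, alternating between two block families. -/
def zigzag {ι α : Type*} (ℓ ℓ' : ι → List α) : List ι → List α
  | [] => []
  | j :: js => ℓ j ++ zigzag ℓ' ℓ js

theorem mem_zigzag {ι α : Type*} {ℓ ℓ' : ι → List α} {js : List ι}
    (h : ∀ j ∈ js, ∀ x, x ∈ ℓ' j ↔ x ∈ ℓ j) (x : α) :
    x ∈ zigzag ℓ ℓ' js ↔ ∃ j ∈ js, x ∈ ℓ j := by
  induction js generalizing ℓ ℓ' with
  | nil => simp [zigzag]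
  | cons j js ih =>
    rw [zigzag, List.mem_append, ih fun i hi y => (h i (List.mem_cons_of_mem _ hi) y).symm]
    simp only [List.mem_cons, exists_eq_or_imp]
    refine or_congr_right (exists_congr fun i => and_congr_right fun hi => ?_)
    exact h i (List.mem_cons_of_mem _ hi) x

theorem nodup_zigzag {ι α : Type*} {ℓ ℓ' : ι → List α} {js : List ι} (hjs : js.Nodup)
    (h : ∀ j ∈ js, ∀ x, x ∈ ℓ' j ↔ x ∈ ℓ j) (hn : ∀ j ∈ js, (ℓ j).Nodup)
    (hn' : ∀ j ∈ js, (ℓ' j).Nodup)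
    (hd : ∀ i ∈ js, ∀ j ∈ js, ∀ x, x ∈ ℓ i → x ∈ ℓ j → i = j) :
    (zigzag ℓ ℓ' js).Nodup := by
  induction js generalizing ℓ ℓ' with
  | nil => simp [zigzag]
  | cons j js ih =>
    have h' : ∀ i ∈ js, ∀ x, x ∈ ℓ i ↔ x ∈ ℓ' i := fun i hi y =>
      (h i (List.mem_cons_of_mem _ hi) y).symm
    rw [List.nodup_cons] at hjs
    rw [zigzag, List.nodup_append']
    refine ⟨hn j (by simp), ih hjs.2 h' (fun i hi => hn' i (by simp [hi]))
      (fun i hi => hn i (by simp [hi])) fun i hi i' hi' x hx hx' =>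
        hd i (by simp [hi]) i' (by simp [hi']) x ((h' i hi x).2 hx) ((h' i' hi' x).2 hx'), ?_⟩
    intro x hx hx'
    obtain ⟨i, hi, hxi⟩ := (mem_zigzag h' x).1 hx'
    exact hjs.1 (hd j (by simp) i (by simp [hi]) x hx ((h' i hi x).2 hxi) ▸ hi)

/-- If all blocks lead from level `u` to level `v` and back, alternately, both levels are cliques, and
`X` is joined to both levels, then the zigzag concatenation followed by `X` is a chain. -/
theorem isChain_zigzag {ι α : Type*} {R : α → α → Prop} {X : α} {ℓ ℓ' : ι → List α} {u v : ι → α}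
    {js : List ι} (hjs : js.Nodup)
    (hc : ∀ j ∈ js, (ℓ j).IsChain R) (hc' : ∀ j ∈ js, (ℓ' j).IsChain R)
    (hh : ∀ j ∈ js, (ℓ j).head? = some (u j)) (hl : ∀ j ∈ js, (ℓ j).getLast? = some (v j))
    (hh' : ∀ j ∈ js, (ℓ' j).head? = some (v j)) (hl' : ∀ j ∈ js, (ℓ' j).getLast? = some (u j))
    (hu : ∀ i ∈ js, ∀ j ∈ js, i ≠ j → R (u i) (u j))
    (hv : ∀ i ∈ js, ∀ j ∈ js, i ≠ j → R (v i) (v j))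
    (hXu : ∀ j ∈ js, R (u j) X) (hXv : ∀ j ∈ js, R (v j) X) :
    (zigzag ℓ ℓ' js ++ [X]).IsChain R ∧
      (zigzag ℓ ℓ' js ++ [X]).head? = ((js.head?.map u).or (some X)) := by
  induction js generalizing ℓ ℓ' u v with
  | nil => simp [zigzag]
  | cons j js ih =>
    rw [List.nodup_cons] at hjs
    -- The two families swap roles after each block, and with them the levels `u` and `v`. The last
    -- level depends on the parity of the number of blocks, hence both levels must be joined to `X`.
    obtain ⟨h1, h2⟩ := ih (ℓ := ℓ') (ℓ' := ℓ) (u := v) (v := u) hjs.2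
      (fun i hi => hc' i (by simp [hi])) (fun i hi => hc i (by simp [hi]))
      (fun i hi => hh' i (by simp [hi])) (fun i hi => hl' i (by simp [hi]))
      (fun i hi => hh i (by simp [hi])) (fun i hi => hl i (by simp [hi]))
      (fun i hi i' hi' => hv i (by simp [hi]) i' (by simp [hi']))
      (fun i hi i' hi' => hu i (by simp [hi]) i' (by simp [hi']))
      (fun i hi => hXv i (by simp [hi])) (fun i hi => hXu i (by simp [hi]))
    rw [zigzag, List.append_assoc]
    refine ⟨(hc j (by simp)).append h1 ?_, by simp [List.head?_append, hh j]⟩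
    intro x hx y hy
    rw [hl j (by simp), Option.mem_some_iff] at hx
    rw [h2] at hy
    subst hx
    cases js with
    | nil =>
      simp only [List.head?_nil, Option.map_none, Option.none_or, Option.mem_some_iff] at hy
      exact hy ▸ hXv j (by simp)
    | cons i js =>
      simp only [List.head?_cons, Option.map_some, Option.some_or, Option.mem_some_iff] at hy
      exact hy ▸ hv j (by simp) i (by simp) fun h => hjs.1 (by simp [h])

/-! ### Exchange paths through dominating sets -/

/-- Two sets of naturals differ in the exchange of one element for another. -/
def Exchange (S T : Finset ℕ) : Prop :=
  ∃ (U : Finset ℕ) (a b : ℕ), a ∉ U ∧ b ∉ U ∧ a ≠ b ∧ S = insert a U ∧ T = insert b U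

theorem Exchange.symm {S T : Finset ℕ} : Exchange S T → Exchange T S := by
  rintro ⟨U, a, b, ha, hb, hab, hS, hT⟩
  exact ⟨U, b, a, hb, ha, hab.symm, hT, hS⟩

theorem Exchange.insert {S T : Finset ℕ} {j : ℕ} (h : Exchange S T) (hS : j ∉ S) (hT : j ∉ T) :
    Exchange (insert j S) (insert j T) := by
  obtain ⟨U, a, b, ha, hb, hab, rfl, rfl⟩ := h
  simp only [Finset.mem_insert, not_or] at hS hT
  refine ⟨Insert.insert j U, a, b, ?_, ?_, hab, Finset.insert_comm .., Finset.insert_comm ..⟩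
  · simp [ha, Ne.symm hS.1]
  · simp [hb, Ne.symm hT.1]

/-- The `k`-subsets of `{0, …, M - 1}` that have at least `c m` elements below `m` for all `m ≤ M`. -/
def DominatingSet (c : ℕ → ℕ) (k M : ℕ) (S : Finset ℕ) : Prop :=
  S ⊆ Finset.range M ∧ S.card = k ∧ ∀ m ≤ M, c m ≤ (S.filter (· < m)).card

/-- The second smallest dominating set, if there are at least two, and otherwise the only one. -/
def secondSet (c : ℕ → ℕ) (k : ℕ) : Finset ℕ :=
  if c k < k then insert k (Finset.range (k - 1)) else Finset.range k

section

variable {c : ℕ → ℕ}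

theorem DominatingSet.notMem {k j : ℕ} {T : Finset ℕ} (h : DominatingSet c k j T) : j ∉ T :=
  fun hj => by simpa using h.1 hj

/-- Here `j` is the maximum of `S`. Removing it changes no count below `m ≤ j`, and for `m > j` all
`k + 1` elements are counted, which is enough by monotonicity and `hM`. -/
theorem dominatingSet_succ_iff (hc : Monotone c) {k M : ℕ} (hM : c M ≤ k + 1) {S : Finset ℕ} :
    DominatingSet c (k + 1) M S ↔ ∃ j < M, ∃ T, DominatingSet c k j T ∧ S = insert j T := by
  constructor
  · rintro ⟨hS, hcard, h⟩
    have hne : S.Nonempty := Finset.card_pos.1 (by omega)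
    have hmax := S.max'_mem hne
    set j := S.max' hne
    have hlt : ∀ x ∈ S.erase j, x < j := fun x hx =>
      lt_of_le_of_ne (S.le_max' x (Finset.mem_of_mem_erase hx)) (Finset.ne_of_mem_erase hx)
    refine ⟨j, Finset.mem_range.1 (hS hmax), S.erase j, ⟨fun x hx => Finset.mem_range.2 (hlt x hx),
      by rw [Finset.card_erase_of_mem hmax, hcard]; rfl, fun m hm => ?_⟩,
      (Finset.insert_erase hmax).symm⟩
    refine (h m (hm.trans (Finset.mem_range.1 (hS hmax)).le)).trans (Finset.card_le_card ?_)
    intro x hx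
    simp only [Finset.mem_filter, Finset.mem_erase] at hx ⊢
    exact ⟨⟨by omega, hx.1⟩, hx.2⟩
  · rintro ⟨j, hj, T, hT, rfl⟩
    have hcard : (insert j T).card = k + 1 := by
      rw [Finset.card_insert_of_notMem hT.notMem, hT.2.1]
    have hsub : ∀ x ∈ insert j T, x ≤ j := by
      intro x hx
      rcases Finset.mem_insert.1 hx with rfl | hx
      · exact le_rfl
      · exact (Finset.mem_range.1 (hT.1 hx)).le
    refine ⟨fun x hx => Finset.mem_range.2 ((hsub x hx).trans_lt hj), hcard, fun m hm => ?_⟩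
    rcases le_or_gt m j with hmj | hmj
    · exact (hT.2.2 m hmj).trans
        (Finset.card_le_card (Finset.filter_subset_filter _ (Finset.subset_insert _ _)))
    · rw [Finset.filter_true_of_mem fun x hx => (hsub x hx).trans_lt hmj, hcard]
      exact (hc hm).trans hM

theorem DominatingSet.insert_inj {k i j : ℕ} {S T : Finset ℕ} (hS : DominatingSet c k i S)
    (hT : DominatingSet c k j T) (h : insert i S = insert j T) : i = j := by
  have h1 : i ∈ insert j T := h ▸ Finset.mem_insert_self i S
  have h2 : j ∈ insert i S := h ▸ Finset.mem_insert_self j T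
  rcases Finset.mem_insert.1 h1 with h1 | h1
  · exact h1
  rcases Finset.mem_insert.1 h2 with h2 | h2
  · exact h2.symm
  have := Finset.mem_range.1 (hT.1 h1)
  have := Finset.mem_range.1 (hS.1 h2)
  omega

theorem DominatingSet.le {k j : ℕ} {T : Finset ℕ} (h : DominatingSet c k j T) :
    k ≤ j ∧ c j ≤ k := by
  refine ⟨?_, (h.2.2 j le_rfl).trans ((Finset.card_filter_le _ _).trans h.2.1.le)⟩
  simpa [h.2.1] using Finset.card_le_card h.1

theorem dominatingSet_self_iff (hck : ∀ m, c m ≤ m) {k : ℕ} {T : Finset ℕ} :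
    DominatingSet c k k T ↔ T = Finset.range k := by
  constructor
  · intro h
    exact Finset.eq_of_subset_of_card_le h.1 (by simp [h.2.1])
  · rintro rfl
    refine ⟨subset_rfl, by simp, fun m hm => ?_⟩
    have : (Finset.range k).filter (· < m) = Finset.range m := by ext x; simp; omega
    rw [this, Finset.card_range]
    exact hck m

theorem secondSet_subset (k : ℕ) : secondSet c k ⊆ Finset.range (k + 1) := by
  intro x
  unfold secondSet
  split_ifs <;> simp <;> omega

/-- The dominating sets can be listed so that consecutive ones differ in an exchange, from the second
smallest to the smallest one. -/
theorem exists_exchange_path (hc : Monotone c) (hck : ∀ m, c m ≤ m) (k : ℕ) :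
    ∀ M, k ≤ M → c M ≤ k → ∃ l : List (Finset ℕ), l.Nodup ∧
      (∀ S, S ∈ l ↔ DominatingSet c k M S) ∧ l.IsChain Exchange ∧
      l.head? = some (if k < M then secondSet c k else Finset.range k) ∧
      l.getLast? = some (Finset.range k) := by
  induction k with
  | zero =>
    intro M _ hM
    refine ⟨[∅], by simp, fun S => ?_, by simp, by simp [secondSet], by simp⟩
    constructor
    · rintro h
      obtain rfl := List.mem_singleton.1 h
      exact ⟨by simp, by simp, fun m hm => by simpa using (hc hm).trans hM⟩
    · intro h
      simpa using h.2.1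
  | succ k ih =>
    intro M hkM hM
    -- Otherwise the initial segment is the only dominating set.
    by_cases hcase : k + 1 < M ∧ c (k + 1) < k + 1
    swap
    · refine ⟨[Finset.range (k + 1)], by simp, fun S => ?_, by simp, ?_, by simp⟩
      · rw [dominatingSet_succ_iff hc hM, List.mem_singleton]
        constructor
        · rintro rfl
          exact ⟨k, hkM, Finset.range k, (dominatingSet_self_iff hck).2 rfl, Finset.range_add_one⟩
        · rintro ⟨j, hj, T, hT, rfl⟩
          have h1 := hT.le
          have : j = k := by
            by_contra hne
            have : c (k + 1) ≤ c j := hc (by omega)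
            exact hcase ⟨by omega, by omega⟩
          subst this
          rw [(dominatingSet_self_iff hck).1 hT, ← Finset.range_add_one]
      · simp only [List.head?_cons, secondSet]
        split_ifs with h1 h2
        · exact absurd ⟨h1, h2⟩ hcase
        · rfl
        · rfl
    -- The value `[]` outside the admissible range only serves to make the chosen `p` total.
    have hex : ∀ j, ∃ l : List (Finset ℕ), k < j → c j ≤ k → l.Nodup ∧
        (∀ S, S ∈ l ↔ DominatingSet c k j S) ∧ l.IsChain Exchange ∧
        l.head? = some (secondSet c k) ∧ l.getLast? = some (Finset.range k) := by
      intro j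
      by_cases hj : k < j ∧ c j ≤ k
      · obtain ⟨l, h⟩ := ih j hj.1.le hj.2
        rw [if_pos hj.1] at h
        exact ⟨l, fun _ _ => h⟩
      · exact ⟨[], fun h1 h2 => absurd ⟨h1, h2⟩ hj⟩
    choose p hp using hex
    -- The maximum `k + 1` comes first and its block is reversed, so that the path starts at `insert
    -- (k + 1) (range k)`, the second smallest set. The order of the other maxima is immaterial. The
    -- maximum `k` belongs only to `range (k + 1)`, which is the final `X`.
    set js : List ℕ := (k + 1) :: (List.range M).filter (fun j => k + 1 < j ∧ c j ≤ k) with hjs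
    have hjs_mem : ∀ j, j ∈ js ↔ k < j ∧ j < M ∧ c j ≤ k := by
      intro j
      simp only [hjs, List.mem_cons, List.mem_filter, List.mem_range, decide_eq_true_eq]
      constructor
      · rintro (rfl | ⟨h1, h2, h3⟩)
        · exact ⟨by omega, hcase.1, by omega⟩
        · exact ⟨by omega, h1, h3⟩
      · rintro ⟨h1, h2, h3⟩
        rcases eq_or_ne j (k + 1) with h | h
        · exact Or.inl h
        · exact Or.inr ⟨h2, by omega, h3⟩
    have hjs_nodup : js.Nodup := by
      rw [hjs, List.nodup_cons]
      exact ⟨by simp, List.nodup_range.filter _⟩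
    have hp' : ∀ j ∈ js, (p j).Nodup ∧ (∀ S, S ∈ p j ↔ DominatingSet c k j S) ∧
        (p j).IsChain Exchange ∧ (p j).head? = some (secondSet c k) ∧
        (p j).getLast? = some (Finset.range k) := fun j hj =>
      hp j ((hjs_mem j).1 hj).1 ((hjs_mem j).1 hj).2.2
    let ℓ' : ℕ → List (Finset ℕ) := fun j => (p j).map (insert j)
    let ℓ : ℕ → List (Finset ℕ) := fun j => (ℓ' j).reverse
    have hmem : ∀ j ∈ js, ∀ S, S ∈ ℓ j ↔ ∃ T, DominatingSet c k j T ∧ S = insert j T := by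
      intro j hj S
      simp only [ℓ, ℓ', List.mem_reverse, List.mem_map, (hp' j hj).2.1]
      exact exists_congr fun T => and_congr_right fun _ => eq_comm
    have hnodup' : ∀ j ∈ js, (ℓ' j).Nodup := by
      intro j hj
      refine (hp' j hj).1.map_on fun S hS T hT h => ?_
      have hS := ((hp' j hj).2.1 S).1 hS
      have hT := ((hp' j hj).2.1 T).1 hT
      rw [← Finset.erase_insert hS.notMem, h, Finset.erase_insert hT.notMem]
    have hchain' : ∀ j ∈ js, (ℓ' j).IsChain Exchange := by
      intro j hj
      rw [List.isChain_map]
      refine (hp' j hj).2.2.1.imp_of_mem_imp fun S T hS hT h => h.insert ?_ ?_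
      · exact (((hp' j hj).2.1 S).1 hS).notMem
      · exact (((hp' j hj).2.1 T).1 hT).notMem
    have hchain : ∀ j ∈ js, (ℓ j).IsChain Exchange := by
      intro j hj
      rw [List.isChain_reverse]
      exact (hchain' j hj).imp fun _ _ => Exchange.symm
    have hrange : ∀ j ∈ js, j ∉ Finset.range k := fun j hj => by
      have := ((hjs_mem j).1 hj).1
      simp; omega
    have hsecond : ∀ j ∈ js, j ∉ secondSet c k := fun j hj h => by
      have := ((hjs_mem j).1 hj).1
      have := Finset.mem_range.1 (secondSet_subset k h)
      omega
    have hself : ∀ j ∈ js, ∀ x, x ∈ ℓ' j ↔ x ∈ ℓ j := fun j _ x => by simp [ℓ]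
    have hroot : ∀ j ∈ js, Exchange (insert j (Finset.range k)) (Finset.range (k + 1)) :=
      fun j hj => ⟨Finset.range k, j, k, hrange j hj, by simp, by
        have := ((hjs_mem j).1 hj).1
        omega, rfl, Finset.range_add_one⟩
    obtain ⟨h1, h2⟩ := isChain_zigzag (R := Exchange) (X := Finset.range (k + 1)) (ℓ := ℓ) (ℓ' := ℓ')
      (u := fun j => insert j (Finset.range k)) (v := fun j => insert j (secondSet c k)) hjs_nodup
      hchain hchain'
      (fun j hj => by simp [ℓ, ℓ', (hp' j hj).2.2.2.2])
      (fun j hj => by simp [ℓ, ℓ', (hp' j hj).2.2.2.1])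
      (fun j hj => by simp [ℓ', (hp' j hj).2.2.2.1])
      (fun j hj => by simp [ℓ', (hp' j hj).2.2.2.2])
      (fun i hi j hj hij => ⟨_, i, j, hrange i hi, hrange j hj, hij, rfl, rfl⟩)
      (fun i hi j hj hij => ⟨_, i, j, hsecond i hi, hsecond j hj, hij, rfl, rfl⟩)
      hroot
      (fun j hj => by
        have hkj := ((hjs_mem j).1 hj).1
        have hs := hsecond j hj
        unfold secondSet at hs ⊢
        split_ifs at hs ⊢ with h
        -- The common part is `{0, …, k - 2, k}`; exchanging `j` for the missing `k - 1` completes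
        -- the initial segment.
        · refine ⟨_, j, k - 1, hs, by simp; omega, by omega, rfl, ?_⟩
          ext x
          simp
          omega
        · exact hroot j hj)
    refine ⟨_, ?_, fun S => ?_, h1, ?_, by simp⟩
    · rw [List.nodup_append']
      refine ⟨nodup_zigzag hjs_nodup hself (fun j hj => List.nodup_reverse.2 (hnodup' j hj)) hnodup'
        ?_, by simp, ?_⟩
      · intro i hi j hj S hS hS'
        obtain ⟨T, hT, rfl⟩ := (hmem i hi S).1 hS
        obtain ⟨T', hT', h⟩ := (hmem j hj _).1 hS'
        exact hT.insert_inj hT' h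
      · intro S hS hS'
        obtain ⟨j, hj, hS⟩ := (mem_zigzag hself S).1 hS
        obtain ⟨T, hT, rfl⟩ := (hmem j hj S).1 hS
        have h := List.mem_singleton.1 hS'
        have : j ∈ Finset.range (k + 1) := h ▸ Finset.mem_insert_self j T
        have := Finset.mem_range.1 this
        have := ((hjs_mem j).1 hj).1
        omega
    · rw [dominatingSet_succ_iff hc hM, List.mem_append, mem_zigzag hself, List.mem_singleton]
      constructor
      · rintro (⟨j, hj, hS⟩ | rfl)
        · obtain ⟨T, hT⟩ := (hmem j hj S).1 hS
          exact ⟨j, ((hjs_mem j).1 hj).2.1, T, hT⟩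
        · exact ⟨k, by omega, Finset.range k, (dominatingSet_self_iff hck).2 rfl,
            Finset.range_add_one⟩
      · rintro ⟨j, hj, T, hT, rfl⟩
        have hle := hT.le
        rcases hle.1.eq_or_lt with rfl | hlt
        · right
          rw [(dominatingSet_self_iff hck).1 hT, ← Finset.range_add_one]
        · have hj' := (hjs_mem j).2 ⟨hlt, hj, hle.2⟩
          exact Or.inl ⟨j, hj', (hmem j hj' _).2 ⟨T, hT, rfl⟩⟩
    · rw [h2, if_pos hcase.1, secondSet, if_pos hcase.2]
      simp [hjs]

end

/-! ### Hamilton cycles from periodic and symmetric sequences -/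

section SymmetricCycle

open SimpleGraph

variable {V : Type*} {G : SimpleGraph V}

theorem exists_walk_getVert_eq (x : ℕ → V) (h : ∀ i, G.Adj (x i) (x (i + 1))) (N : ℕ) :
    ∃ p : G.Walk (x 0) (x N), p.length = N ∧ ∀ i ≤ N, p.getVert i = x i := by
  induction N generalizing x with
  | zero => exact ⟨.nil, rfl, fun i hi => by simp [Nat.le_zero.1 hi]⟩
  | succ N ih =>
    obtain ⟨p, hp, hv⟩ := ih (fun i => x (i + 1)) fun i => h (i + 1)
    refine ⟨.cons (h 0) p, by simp [hp], fun i hi => ?_⟩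
    cases i with
    | zero => rfl
    | succ i => simpa using hv i (by omega)

theorem exists_isHamiltonianCycle_getVert_eq [DecidableEq V] (x : ℕ → V) {N : ℕ} (hN : 3 ≤ N)
    (h : ∀ i, G.Adj (x i) (x (i + 1))) (hper : Function.Periodic x N)
    (hinj : ∀ i < N, ∀ j < N, x i = x j → i = j) (hsurj : ∀ v, ∃ i < N, x i = v) :
    ∃ C : G.Walk (x 0) (x 0), C.IsHamiltonianCycle ∧ C.length = N ∧
      ∀ i ≤ N, C.getVert i = x i := by
  obtain ⟨p, hp, hv⟩ := exists_walk_getVert_eq x h N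
  have h0 : x N = x 0 := by simpa using hper 0
  refine ⟨p.copy rfl h0, ?_, by simpa using hp, fun i hi => by simpa using hv i hi⟩
  set C := p.copy rfl h0 with hC
  have hlen : C.length = N := by simpa [hC] using hp
  have hvert : ∀ i ≤ N, C.getVert i = x i := fun i hi => by simpa [hC] using hv i hi
  have hnil : ¬ C.Nil := by
    rw [← Walk.length_eq_zero_iff]
    omega
  have htlen : C.tail.length + 1 = N := by rw [Walk.length_tail_add_one hnil, hlen]
  have hpath : C.tail.IsPath := by
    rw [← Walk.IsPath.getVert_injOn_iff]
    intro i hi j hj hij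
    simp only [Set.mem_ofPred_eq] at hi hj
    rw [Walk.getVert_tail, Walk.getVert_tail, hvert _ (by omega), hvert _ (by omega)] at hij
    -- The tail runs through the indices `1, …, N`, so `N` has to be reduced to `0` before `hinj`
    -- applies.
    have hmod : ∀ m, x m = x (m % N) := fun m => (hper.map_mod_nat m).symm
    rw [hmod (i + 1), hmod (j + 1)] at hij
    have := hinj _ (Nat.mod_lt _ (by omega)) _ (Nat.mod_lt _ (by omega)) hij
    rcases (show i + 1 ≤ N by omega).eq_or_lt with hi' | hi' <;>
    rcases (show j + 1 ≤ N by omega).eq_or_lt with hj' | hj'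
    · omega
    · rw [hi', Nat.mod_self, Nat.mod_eq_of_lt hj'] at this; omega
    · rw [hj', Nat.mod_self, Nat.mod_eq_of_lt hi'] at this; omega
    · rw [Nat.mod_eq_of_lt hi', Nat.mod_eq_of_lt hj'] at this; omega
  refine ⟨Walk.isCycle_iff_isPath_tail_and_le_length.2 ⟨hpath, by omega⟩, ?_⟩
  rw [hpath.isHamiltonian_iff]
  intro v
  obtain ⟨i, hi, rfl⟩ := hsurj v
  rw [Walk.mem_support_iff_exists_getVert]
  rcases Nat.eq_zero_or_pos i with rfl | hpos
  · refine ⟨N - 1, ?_, by omega⟩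
    rw [Walk.getVert_tail, hvert _ (by omega), Nat.sub_add_cancel (by omega), h0]
  · refine ⟨i - 1, ?_, by omega⟩
    rw [Walk.getVert_tail, hvert _ (by omega), Nat.sub_add_cancel hpos]

/-- A path that meets every orbit of the automorphism `f` of order `n` in one vertex, each orbit having
size `n`, and whose end is adjacent to the image of its start, extends to a sequence through
all vertices on which `f` acts as a shift. -/
theorem exists_symmetric_sequence (f : G ≃g G) {n : ℕ} (hfn : ∀ v, f^[n] v = v) {l : List V}
    (hnodup : l.Nodup) (hchain : l.IsChain G.Adj) {s r : V} (hs : l.head? = some s)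
    (hr : l.getLast? = some r) (hrs : G.Adj r (f s))
    (hinj : ∀ x ∈ l, ∀ y ∈ l, ∀ i < n, ∀ j < n, f^[i] x = f^[j] y → i = j)
    (hsurj : ∀ v, ∃ i < n, ∃ x ∈ l, f^[i] x = v) :
    ∃ x : ℕ → V, (∀ i, G.Adj (x i) (x (i + 1))) ∧ (∀ i, x (i + l.length) = f (x i)) ∧
      Function.Periodic x (n * l.length) ∧
      (∀ i < n * l.length, ∀ j < n * l.length, x i = x j → i = j) ∧
      ∀ v, ∃ i < n * l.length, x i = v := by
  have hM : 0 < l.length := by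
    rw [List.length_pos_iff]
    rintro rfl
    simp at hs
  set M := l.length with hMdef
  have hlt : ∀ i, i % M < l.length := fun i => Nat.mod_lt _ hM
  -- Block number `q` of length `M` is the image of the path under `f^[q]`.
  let x : ℕ → V := fun i => f^[i / M] (l[i % M]'(hlt i))
  have hadj : ∀ (q : ℕ) {u v : V}, G.Adj u v → G.Adj (f^[q] u) (f^[q] v) := by
    intro q
    induction q with
    | zero => exact fun h => h
    | succ q ih =>
      intro u v h
      rw [Function.iterate_succ_apply', Function.iterate_succ_apply']
      exact f.map_adj_iff.2 (ih h)
  have hstep : ∀ q i, x (i + q * M) = f^[q] (x i) := by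
    intro q i
    simp only [x, Nat.add_mul_div_right _ _ hM, Nat.add_mul_mod_self_right]
    rw [Nat.add_comm, Function.iterate_add_apply]
  have hx : ∀ q i (hi : i < M), x (i + q * M) = f^[q] l[i] := by
    intro q i hi
    rw [hstep]
    simp [x, Nat.div_eq_of_lt hi, Nat.mod_eq_of_lt hi]
  have hdecomp : ∀ i, i = i % M + i / M * M := fun i => (Nat.mod_add_div' i M).symm
  have h0 : l[0] = s := by
    rw [List.head?_eq_getElem?, List.getElem?_eq_getElem hM] at hs
    simpa using hs
  have hlast : l[M - 1] = r := by
    rw [List.getLast?_eq_getElem?, List.getElem?_eq_getElem (by omega)] at hr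
    simpa using hr
  refine ⟨x, fun i => ?_, fun i => by simpa using hstep 1 i, fun i => ?_, ?_, fun v => ?_⟩
  · have hi := hlt i
    rw [hdecomp i]
    generalize i % M = a at hi ⊢
    generalize i / M = q
    rcases (show a + 1 ≤ M from hi).eq_or_lt with ha | ha
    · have : a + q * M + 1 = 0 + (q + 1) * M := by rw [Nat.add_mul]; omega
      rw [this, hx _ _ hM, hx _ _ hi, Function.iterate_succ_apply, h0]
      obtain rfl : a = M - 1 := by omega
      rw [hlast]
      exact hadj q hrs
    · rw [show a + q * M + 1 = a + 1 + q * M by omega, hx _ _ ha, hx _ _ hi]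
      exact hadj q (List.isChain_iff_getElem.1 hchain a ha)
  · rw [hstep, hfn]
  · intro i hi j hj hij
    have hij' : f^[i / M] (l[i % M]'(hlt i)) = f^[j / M] (l[j % M]'(hlt j)) := hij
    have h1 := hinj _ (List.getElem_mem _) _ (List.getElem_mem _) _
      (Nat.div_lt_of_lt_mul (by rwa [Nat.mul_comm])) _
      (Nat.div_lt_of_lt_mul (by rwa [Nat.mul_comm])) hij'
    rw [h1] at hij'
    have h2 := (hnodup.getElem_inj_iff).1 ((f.injective.iterate _) hij')
    rw [hdecomp i, hdecomp j, h1, h2]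
  · obtain ⟨i, hi, y, hy, rfl⟩ := hsurj v
    obtain ⟨a, ha, rfl⟩ := List.getElem_of_mem hy
    refine ⟨a + i * M, ?_, hx i a ha⟩
    calc a + i * M < M + i * M := by omega
      _ = (i + 1) * M := by ring
      _ ≤ n * M := Nat.mul_le_mul_right _ hi

end SymmetricCycle

/-! ### The cycle lemma for rational Dyck words -/

section Rotations

variable {n k : ℕ} [NeZero n]

theorem ofNat_eq_mk {j : ℕ} (h : j < n) : Fin.ofNat n j = ⟨j, h⟩ :=
  Fin.ext (Nat.mod_eq_of_lt h)

theorem ofNat_eq_zero {j : ℕ} (h : j = n) : Fin.ofNat n j = ⟨0, NeZero.pos n⟩ :=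
  Fin.ext (by simp [h])

theorem finRotate_eq_ofNat (i : Fin n) : finRotate n i = Fin.ofNat n (i.1 + 1) := by
  rw [finRotate_apply]
  ext
  simp [Fin.val_add]

theorem leftShift_iterate_apply (x : Combination n k) (t : ℕ) (i : ℕ) :
    ((leftShift n k)^[t] x).1 (Fin.ofNat n i) = x.1 (Fin.ofNat n (t + i)) := by
  induction t generalizing i with
  | zero => simp
  | succ t ih =>
    rw [Function.iterate_succ_apply']
    have : (leftShift n k ((leftShift n k)^[t] x)).1 (Fin.ofNat n i) =
      ((leftShift n k)^[t] x).1 (finRotate n (Fin.ofNat n i)) := rfl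
    rw [this, finRotate_eq_ofNat]
    have : Fin.ofNat n ((Fin.ofNat n i).1 + 1) = Fin.ofNat n (i + 1) := by
      ext
      simp
    rw [this, ih, show t + (i + 1) = t + 1 + i by omega]

theorem leftShift_iterate_self (x : Combination n k) : (leftShift n k)^[n] x = x := by
  apply Subtype.ext
  funext i
  have h := leftShift_iterate_apply x n i.1
  have h1 : Fin.ofNat n i.1 = i := Fin.ofNat_val_eq_self i
  have h2 : Fin.ofNat n (n + i.1) = i := by ext; simp [Nat.mod_eq_of_lt i.2]
  rwa [h1, h2] at h

/-- The number of ones among the first `m` bits of the `n`-periodic continuation of `x`. -/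
def prefixOnes (x : Combination n k) (m : ℕ) : ℕ :=
  ∑ i ∈ Finset.range m, if x.1 (Fin.ofNat n i) = true then 1 else 0

theorem prefixOnes_add (x : Combination n k) (t m : ℕ) :
    prefixOnes x (t + m) = prefixOnes x t + prefixOnes ((leftShift n k)^[t] x) m := by
  simp only [prefixOnes, Finset.sum_range_add, leftShift_iterate_apply]

theorem prefixOnes_self (x : Combination n k) : prefixOnes x n = k := by
  rw [prefixOnes, Finset.sum_range]
  conv_rhs => rw [← x.2, Finset.card_filter]
  refine Finset.sum_congr rfl fun i _ => ?_
  have h1 : Fin.ofNat n i.1 = i := Fin.ofNat_val_eq_self i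
  rw [h1]

/-- The rational Dyck words: every prefix has at least its proportional share of ones. -/
def IsDyck (x : Combination n k) : Prop := ∀ m ≤ n, m * k ≤ n * prefixOnes x m

/-- Existence part of the cycle lemma. -/
theorem exists_isDyck_rotation (x : Combination n k) :
    ∃ t < n, ∃ y, IsDyck y ∧ (leftShift n k)^[t] y = x := by
  have hn : 0 < n := NeZero.pos n
  let h : ℕ → ℤ := fun t => n * prefixOnes x t - t * k
  have hper : Function.Periodic h n := by
    intro t
    simp only [h]
    rw [Nat.add_comm t n, prefixOnes_add, prefixOnes_self, leftShift_iterate_self]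
    push_cast
    ring
  -- Reading the word from a minimum of the height function `h` keeps all later heights at or above
  -- the starting one, which is the Dyck condition.
  obtain ⟨t, ht, hmin⟩ := Finset.exists_min_image (Finset.range n) h ⟨0, by simpa using hn⟩
  rw [Finset.mem_range] at ht
  have hdyck : IsDyck ((leftShift n k)^[t] x) := by
    intro m _
    have h1 := hmin ((t + m) % n) (by simpa using Nat.mod_lt _ hn)
    rw [hper.map_mod_nat] at h1
    simp only [h, prefixOnes_add] at h1
    push_cast at h1
    zify
    nlinarith
  rcases Nat.eq_zero_or_pos t with rfl | hpos
  · exact ⟨0, hn, _, hdyck, rfl⟩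
  · refine ⟨n - t, by omega, _, hdyck, ?_⟩
    rw [← Function.iterate_add_apply, Nat.sub_add_cancel ht.le, leftShift_iterate_self]

/-- The Dyck condition of `x` bounds the ones among its first `d` bits from below by `dk/n`, that of
the rotation bounds them from above by the same number. Equality makes `n` divide `dk`, hence `d` by
coprimality. -/
theorem IsDyck.eq_zero_of_rotation (hcop : Nat.Coprime n k) {x : Combination n k} {d : ℕ}
    (hd : d < n) (hx : IsDyck x) (hy : IsDyck ((leftShift n k)^[d] x)) : d = 0 := by
  have h1 := hx d hd.le
  have h2 := hy (n - d) (Nat.sub_le _ _)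
  have h3 := prefixOnes_add x d (n - d)
  rw [Nat.add_sub_cancel' hd.le, prefixOnes_self] at h3
  have h4 : n * prefixOnes x d = d * k := by
    zify [hd.le] at h1 h2 h3 ⊢
    refine le_antisymm ?_ h1
    rw [h3] at h2 ⊢
    nlinarith
  exact Nat.eq_zero_of_dvd_of_lt (hcop.dvd_of_dvd_mul_right ⟨_, h4.symm⟩) hd

/-- Uniqueness part of the cycle lemma. -/
theorem IsDyck.rotation_unique (hcop : Nat.Coprime n k) {x y : Combination n k} (hx : IsDyck x)
    (hy : IsDyck y) {s t : ℕ} (hs : s < n) (ht : t < n)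
    (h : (leftShift n k)^[s] x = (leftShift n k)^[t] y) : s = t := by
  wlog hst : s ≤ t generalizing x y s t
  · exact (this hy hx ht hs h.symm (by omega)).symm
  obtain ⟨d, rfl⟩ := Nat.exists_eq_add_of_le hst
  rw [Function.iterate_add_apply] at h
  have hxy := (leftShift n k).injective.iterate s h
  have := hy.eq_zero_of_rotation hcop (by omega) (hxy ▸ hx)
  omega

end Rotations

/-! ### Combinations as sets of positions, and the path of Dyck words -/

section Supports

variable {n k : ℕ}

/-- The positions of the ones of `x`, as a set of naturals. -/
def onesSet (x : Combination n k) : Finset ℕ :=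
  (Finset.univ.filter fun i => x.1 i = true).map Fin.valEmbedding

theorem mem_onesSet {x : Combination n k} {j : ℕ} :
    j ∈ onesSet x ↔ ∃ h : j < n, x.1 ⟨j, h⟩ = true := by
  simp only [onesSet, Finset.mem_map, Finset.mem_filter, Finset.mem_univ, true_and,
    Fin.valEmbedding_apply]
  constructor
  · rintro ⟨i, hi, rfl⟩
    exact ⟨i.2, hi⟩
  · rintro ⟨h, hx⟩
    exact ⟨⟨j, h⟩, hx, rfl⟩

theorem val_mem_onesSet {x : Combination n k} {i : Fin n} : i.1 ∈ onesSet x ↔ x.1 i = true := by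
  simp [mem_onesSet]

theorem onesSet_injective : Function.Injective (onesSet : Combination n k → Finset ℕ) := by
  intro x y h
  apply Subtype.ext
  funext i
  rw [Bool.eq_iff_iff, ← val_mem_onesSet, ← val_mem_onesSet, h]

theorem exists_onesSet_eq {S : Finset ℕ} (hS : S ⊆ Finset.range n) (hk : S.card = k) :
    ∃ x : Combination n k, onesSet x = S := by
  have key : (Finset.univ.filter fun i : Fin n => decide (i.1 ∈ S) = true).map Fin.valEmbedding = S := by
    ext j
    simp only [Finset.mem_map, Finset.mem_filter, Finset.mem_univ, true_and, decide_eq_true_eq,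
      Fin.valEmbedding_apply]
    constructor
    · rintro ⟨i, hi, rfl⟩
      exact hi
    · intro hj
      exact ⟨⟨j, Finset.mem_range.1 (hS hj)⟩, hj, rfl⟩
  refine ⟨⟨fun i => decide (i.1 ∈ S), ?_⟩, key⟩
  rw [← Finset.card_map Fin.valEmbedding, key, hk]

theorem johnsonGraph_adj_of_exchange {x y : Combination n k} (h : Exchange (onesSet x) (onesSet y)) :
    (johnsonGraph n k).Adj x y := by
  obtain ⟨U, a, b, ha, hb, hab, hx, hy⟩ := h
  obtain ⟨han, -⟩ := mem_onesSet.1 (hx ▸ Finset.mem_insert_self a U)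
  obtain ⟨hbn, -⟩ := mem_onesSet.1 (hy ▸ Finset.mem_insert_self b U)
  have hx' : ∀ i : Fin n, x.1 i = true ↔ i.1 = a ∨ i.1 ∈ U := fun i => by
    rw [← val_mem_onesSet, hx, Finset.mem_insert]
  have hy' : ∀ i : Fin n, y.1 i = true ↔ i.1 = b ∨ i.1 ∈ U := fun i => by
    rw [← val_mem_onesSet, hy, Finset.mem_insert]
  refine ⟨⟨b, hbn⟩, ⟨a, han⟩, ?_, ?_, ?_⟩
  · rw [Bool.eq_false_iff, Ne, hx']
    simp [hb, hab.symm]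
  · rw [hx']
    simp
  · funext i
    rw [Bool.eq_iff_iff, hy', Function.comp_apply, hx']
    rcases eq_or_ne i ⟨b, hbn⟩ with rfl | hib
    · simp
    rcases eq_or_ne i ⟨a, han⟩ with rfl | hia
    · simp [ha, hb, hab, hab.symm]
    · rw [Equiv.swap_apply_of_ne_of_ne hib hia]
      simp only [ne_eq, Fin.ext_iff] at hib hia
      simp [hib, hia]

theorem card_combination (n k : ℕ) : Fintype.card (Combination n k) = n.choose k := by
  rw [← Finset.card_range n, ← Finset.card_powersetCard, Finset.card_range, ← Finset.card_univ]
  refine Finset.card_bij (fun x _ => onesSet x) (fun x _ => ?_) (fun x _ y _ h => onesSet_injective h)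
    fun S hS => ?_
  · rw [Finset.mem_powersetCard]
    refine ⟨fun j hj => ?_, ?_⟩
    · exact Finset.mem_range.2 (mem_onesSet.1 hj).1
    · rw [onesSet, Finset.card_map, x.2]
  · rw [Finset.mem_powersetCard] at hS
    obtain ⟨x, hx⟩ := exists_onesSet_eq hS.1 hS.2
    exact ⟨x, Finset.mem_univ _, hx⟩

theorem mem_onesSet_leftShift [NeZero n] {x : Combination n k} {j : ℕ} :
    j ∈ onesSet (leftShift n k x) ↔
      (j + 1 < n ∧ j + 1 ∈ onesSet x) ∨ (j + 1 = n ∧ 0 ∈ onesSet x) := by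
  have key : ∀ h : j < n, (leftShift n k x).1 ⟨j, h⟩ = x.1 (Fin.ofNat n (j + 1)) := fun h => by
    rw [← finRotate_eq_ofNat ⟨j, h⟩]
    rfl
  simp only [mem_onesSet, key]
  constructor
  · rintro ⟨h, hx⟩
    rcases (show j + 1 ≤ n from h).eq_or_lt with h' | h'
    · rw [ofNat_eq_zero h'] at hx
      exact Or.inr ⟨h', NeZero.pos n, hx⟩
    · rw [ofNat_eq_mk h'] at hx
      exact Or.inl ⟨h', h', hx⟩
  · rintro (⟨h, h', hx⟩ | ⟨h, h', hx⟩)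
    · exact ⟨by omega, by rwa [ofNat_eq_mk h]⟩
    · exact ⟨by omega, by rwa [ofNat_eq_zero h]⟩

theorem prefixOnes_eq_card [NeZero n] (x : Combination n k) {m : ℕ} (hm : m ≤ n) :
    prefixOnes x m = ((onesSet x).filter (· < m)).card := by
  rw [prefixOnes, ← Finset.card_filter]
  congr 1
  ext j
  simp only [Finset.mem_filter, Finset.mem_range, mem_onesSet]
  constructor
  · rintro ⟨hj, hx⟩
    rw [ofNat_eq_mk (by omega)] at hx
    exact ⟨⟨by omega, hx⟩, hj⟩
  · rintro ⟨⟨hj', hx⟩, hj⟩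
    exact ⟨hj, by rwa [ofNat_eq_mk hj']⟩

theorem isDyck_iff_dominatingSet [NeZero n] (x : Combination n k) :
    IsDyck x ↔ DominatingSet (fun m => m * k ⌈/⌉ n) k n (onesSet x) := by
  have hn : 0 < n := NeZero.pos n
  have h1 : onesSet x ⊆ Finset.range n := fun j hj => Finset.mem_range.2 (mem_onesSet.1 hj).1
  have h2 : (onesSet x).card = k := by rw [onesSet, Finset.card_map, x.2]
  simp only [IsDyck, DominatingSet, h1, h2, true_and]
  refine forall₂_congr fun m hm => ?_
  rw [ceilDiv_le_iff_le_mul hn, prefixOnes_eq_card x hm]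

/-- The Dyck words form a path in the Johnson graph whose end is adjacent to the shifted start. -/
theorem exists_dyck_path [NeZero n] (hk : 0 < k) (hkn : k < n) :
    ∃ (l : List (Combination n k)) (s r : Combination n k), l.Nodup ∧ (∀ x, x ∈ l ↔ IsDyck x) ∧
      l.IsChain (johnsonGraph n k).Adj ∧ l.head? = some s ∧ l.getLast? = some r ∧
      (johnsonGraph n k).Adj r (leftShift n k s) := by
  have hn : 0 < n := NeZero.pos n
  set c : ℕ → ℕ := fun m => m * k ⌈/⌉ n with hc
  have hmono : Monotone c := by
    intro a b hab
    simp only [hc]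
    rw [ceilDiv_le_iff_le_mul hn]
    exact (Nat.mul_le_mul_right k hab).trans ((ceilDiv_le_iff_le_mul hn).1 le_rfl)
  have hle : ∀ m, c m ≤ m := by
    intro m
    simp only [hc]
    rw [ceilDiv_le_iff_le_mul hn, Nat.mul_comm]
    exact Nat.mul_le_mul_right m hkn.le
  have hcn : c n ≤ k := by
    simp only [hc]
    rw [ceilDiv_le_iff_le_mul hn]
  obtain ⟨l, hnodup, hmem, hchain, hhead, hlast⟩ := exists_exchange_path hmono hle k n hkn.le hcn
  have hl : l ∈ Set.range (List.map (onesSet : Combination n k → Finset ℕ)) := by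
    rw [Set.range_list_map]
    intro S hS
    have := (hmem S).1 hS
    exact exists_onesSet_eq this.1 this.2.1
  obtain ⟨l, rfl⟩ := hl
  rw [List.head?_map, Option.map_eq_some_iff] at hhead
  rw [List.getLast?_map, Option.map_eq_some_iff] at hlast
  obtain ⟨s, hs, hs'⟩ := hhead
  obtain ⟨r, hr, hr'⟩ := hlast
  rw [List.isChain_map] at hchain
  refine ⟨l, s, r, hnodup.of_map, fun x => ?_,
    hchain.imp fun _ _ => johnsonGraph_adj_of_exchange, hs, hr, johnsonGraph_adj_of_exchange ?_⟩
  · rw [isDyck_iff_dominatingSet, ← hmem, List.mem_map_of_injective onesSet_injective]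
  · rw [if_pos hkn, secondSet] at hs'
    rw [hr']
    split_ifs at hs' with hck
    -- A Dyck word with `k > 0` starts with a one, so for `k = 1` there is no second word.
    · have hk2 : k ≠ 1 := by
        rintro rfl
        have : 1 * 1 ⌈/⌉ n ≤ 0 := Nat.lt_one_iff.1 hck |>.le
        rw [ceilDiv_le_iff_le_mul hn] at this
        omega
      -- The start `{0, …, k - 2, k}` shifts to `{0, …, k - 3, k - 1, n - 1}`, which differs from
      -- `range k` by exchanging `k - 2` for `n - 1`.
      refine ⟨insert (k - 1) (Finset.range (k - 2)), k - 2, n - 1, by simp; omega, by simp; omega,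
        by omega, ?_, ?_⟩
      · ext j
        simp
        omega
      · ext j
        rw [mem_onesSet_leftShift, hs']
        simp
        omega
    -- Now the path is the single word `range k`, and the shift moves its element `0` to `n - 1`.
    · refine ⟨Finset.range (k - 1), k - 1, n - 1, by simp, by simp; omega, by omega, ?_, ?_⟩
      · ext j
        simp
        omega
      · ext j
        rw [mem_onesSet_leftShift, hs']
        simp
        omega

end Supports

/-! ### Tracks and balance from the symmetry -/

theorem eq_of_finRotate_invariant {α : Type*} {n : ℕ} {g : Fin n → α}
    (h : ∀ j, g (finRotate n j) = g j) (i j : Fin n) : g i = g j := by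
  have key : ∀ (m : ℕ) (hm : m < n), g ⟨m, hm⟩ = g ⟨0, by omega⟩ := by
    intro m
    induction m with
    | zero => exact fun _ => rfl
    | succ m ih =>
      intro hm
      have : NeZero n := ⟨by omega⟩
      rw [← ih (by omega), ← h ⟨m, by omega⟩, finRotate_eq_ofNat]
      congr 1
      ext
      simp [Nat.mod_eq_of_lt hm]
  exact (key i.1 i.2).trans (key j.1 j.2).symm

/-- In every step of the Johnson graph exactly one bit changes from `b` to its complement. -/
theorem card_flips_eq_one {n k : ℕ} {x y : Combination n k} (h : (johnsonGraph n k).Adj x y)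
    (b : Bool) : (Finset.univ.filter fun j => x.1 j = b ∧ y.1 j = !b).card = 1 := by
  obtain ⟨p, q, hp, hq, hy⟩ := h
  have hpq : p ≠ q := by
    rintro rfl
    simp [hp] at hq
  rw [Finset.card_eq_one]
  have hswap : ∀ j, x.1 j = b ∧ y.1 j = !b → j = p ∨ j = q := by
    rintro j ⟨h1, h2⟩
    by_contra! hne
    rw [hy, Function.comp_apply, Equiv.swap_apply_of_ne_of_ne hne.1 hne.2, h1] at h2
    simp at h2
  refine ⟨if b then q else p, ?_⟩
  ext j
  simp only [Finset.mem_filter, Finset.mem_univ, true_and, Finset.mem_singleton]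
  constructor
  · intro hj
    rcases hswap j hj with rfl | rfl
    · rw [hp] at hj
      simp [← hj.1]
    · rw [hq] at hj
      simp [← hj.1]
  · rintro rfl
    cases b <;> simp [hp, hq, hy]

section Sequences

variable {n k : ℕ} {v : Combination n k} {C : (johnsonGraph n k).Walk v v}
  {x : ℕ → Combination n k} {M : ℕ}

theorem hasTracks_one_of_shift (hn : 0 < n) (hlen : C.length = n * M)
    (hC : ∀ i ≤ n * M, C.getVert i = x i) (hx : ∀ i, x (i + M) = leftShift n k (x i))
    (hper : Function.Periodic x (n * M)) : HasTracks C 1 := by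
  refine ⟨{⟨0, hn⟩}, rfl, fun j => ⟨⟨0, hn⟩, by simp, ?_⟩⟩
  have hrot : ∀ j, column C (finRotate n j) = (column C j).rotate M := by
    intro j
    refine List.ext_getElem (by simp [column]) fun i h1 h2 => ?_
    have hi : i < n * M := by simpa [column, hlen] using h1
    rw [List.getElem_rotate]
    simp only [column, List.getElem_map, List.getElem_range, List.length_map, List.length_range]
    rw [hlen, hC _ hi.le, hC _ (Nat.mod_lt _ (by omega)).le, hper.map_mod_nat, hx]
    rfl
  -- Passing to `Cycle` turns "equal up to rotation" into equality, so that the invariance lemma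
  -- applies.
  have := eq_of_finRotate_invariant (g := fun j => (column C j : Cycle Bool))
    (fun j => by
      rw [hrot, Cycle.coe_eq_coe]
      exact List.IsRotated.symm ⟨M, rfl⟩) ⟨0, hn⟩ j
  exact Cycle.coe_eq_coe.1 this

/-- All columns have the same count by symmetry, and the counts sum to the number `n * M` of steps,
since each step contributes one flip from `b`. -/
theorem flipCountFrom_eq_of_shift (hn : 0 < n) (hlen : C.length = n * M)
    (hC : ∀ i ≤ n * M, C.getVert i = x i) (hx : ∀ i, x (i + M) = leftShift n k (x i))
    (hper : Function.Periodic x (n * M)) (hadj : ∀ i, (johnsonGraph n k).Adj (x i) (x (i + 1)))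
    (j : Fin n) (b : Bool) : flipCountFrom C j b = M := by
  let P : Fin n → ℕ → Prop := fun j i => (x i).1 j = b ∧ (x (i + 1)).1 j = !b
  have hflip : ∀ j, flipCountFrom C j b = ((Finset.range (n * M)).filter (P j)).card := by
    intro j
    rw [flipCountFrom, hlen]
    congr 1
    refine Finset.filter_congr fun i hi => ?_
    rw [Finset.mem_range] at hi
    rw [hC i hi.le, hC (i + 1) hi]
  have hPper : ∀ j, Function.Periodic (P j) (n * M) := by
    intro j i
    simp only [P]
    rw [Nat.add_right_comm, hper, hper]
  have hrot : ∀ j i, P (finRotate n j) i = P j (i + M) := by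
    intro j i
    simp only [P]
    rw [Nat.add_right_comm, hx, hx]
    rfl
  have hinv : ∀ j, flipCountFrom C (finRotate n j) b = flipCountFrom C j b := by
    intro j
    rw [hflip, hflip]
    -- Flips of the next column over one period are flips of column `j` over the period starting at
    -- `M`; by periodicity the window does not matter.
    have h1 := Nat.filter_Ico_card_eq_of_periodic M (n * M) (P j) (hPper j)
    have h2 := Nat.filter_Ico_card_eq_of_periodic 0 (n * M) (P j) (hPper j)
    rw [Nat.zero_add, ← Finset.range_eq_Ico] at h2
    rw [h2, ← h1]
    refine Finset.card_bij (fun i _ => i + M) ?_ ?_ ?_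
    · intro i hi
      simp only [Finset.mem_filter, Finset.mem_range, Finset.mem_Ico, hrot] at hi ⊢
      exact ⟨by omega, hi.2⟩
    · intro i _ i' _ h
      omega
    · intro i hi
      simp only [Finset.mem_filter, Finset.mem_range, Finset.mem_Ico, hrot] at hi ⊢
      refine ⟨i - M, ⟨by omega, ?_⟩, by omega⟩
      rw [Nat.sub_add_cancel hi.1.1]
      exact hi.2
  have hsum : ∑ j : Fin n, flipCountFrom C j b = n * M := by
    simp only [hflip, Finset.card_filter]
    rw [Finset.sum_comm]
    simp only [← Finset.card_filter, P, card_flips_eq_one (hadj _) b]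
    simp
  rw [Finset.sum_congr rfl fun i _ => eq_of_finRotate_invariant
    (g := fun i => flipCountFrom C i b) hinv i j, Finset.sum_const, Finset.card_univ, Fintype.card_fin,
    smul_eq_mul] at hsum
  exact Nat.eq_of_mul_eq_mul_left hn hsum

end Sequences

theorem flipCount_eq_add {n k : ℕ} {v : Combination n k} (C : (johnsonGraph n k).Walk v v)
    (j : Fin n) : flipCount C j = flipCountFrom C j true + flipCountFrom C j false := by
  rw [flipCount, flipCountFrom, flipCountFrom, ← Finset.card_union_of_disjoint]
  · congr 1
    ext i
    simp only [Finset.mem_filter, Finset.mem_union]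
    cases (C.getVert i).1 j <;> cases (C.getVert (i + 1)).1 j <;> simp
  · rw [Finset.disjoint_filter]
    intro i _ h1 h2
    simp [h1.1] at h2

theorem mainTheorem9 (n k : ℕ) (hk : 0 < k) (hkn : k < n) (hn : 3 ≤ n) (hcop : Nat.Coprime n k) :
    n ∣ n.choose k ∧
    ∃ (v : Combination n k) (C : (johnsonGraph n k).Walk v v),
      C.IsHamiltonianCycle ∧
      IsSymmetricUnder C n (leftShift n k) ∧
      HasTracks C 1 ∧
      (∀ j : Fin n, flipCount C j = 2 * (n.choose k / n)) ∧
      (∀ (j : Fin n) (b : Bool), flipCountFrom C j b = n.choose k / n) := by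
  have hn0 : 0 < n := by omega
  have : NeZero n := ⟨hn0.ne'⟩
  obtain ⟨l, s, r, hnodup, hmem, hchain, hs, hr, hrs⟩ := exists_dyck_path (n := n) hk hkn
  obtain ⟨x, hadj, hx, hper, hinj, hsurj⟩ := exists_symmetric_sequence (leftShift n k)
    leftShift_iterate_self hnodup hchain hs hr hrs
    (fun y hy z hz i hi j hj => ((hmem y).1 hy).rotation_unique hcop ((hmem z).1 hz) hi hj)
    (fun v => by
      obtain ⟨t, ht, y, hy, h⟩ := exists_isDyck_rotation v
      exact ⟨t, ht, y, (hmem y).2 hy, h⟩)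
  have hM : 0 < l.length := by
    rw [List.length_pos_iff]
    rintro rfl
    simp at hs
  set M := l.length
  obtain ⟨C, hham, hlen, hC⟩ := exists_isHamiltonianCycle_getVert_eq x
    (hn.trans (Nat.le_mul_of_pos_right n hM)) hadj hper hinj hsurj
  -- The divisibility is a by-product: the Hamilton cycle has `n * M` steps and visits all
  -- combinations.
  have hchoose : n.choose k = n * M := by rw [← card_combination, ← hham.length_eq, hlen]
  have hdiv : n.choose k / n = M := by rw [hchoose, Nat.mul_div_cancel_left _ hn0]
  have hflip := flipCountFrom_eq_of_shift hn0 hlen hC hx hper hadj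
  refine ⟨⟨M, hchoose⟩, x 0, C, hham, ⟨⟨M, hlen⟩, fun i hi => ?_⟩,
    hasTracks_one_of_shift hn0 hlen hC hx hper, fun j => ?_, fun j b => ?_⟩
  · rw [hlen] at hi ⊢
    rw [Nat.mul_div_cancel_left _ hn0, hC i hi.le, hC _ (Nat.mod_lt _ (by omega)).le,
      hper.map_mod_nat, hx]
  · rw [flipCount_eq_add, hflip, hflip, hdiv]
    ring
  · rw [hflip, hdiv]
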